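/- Let $X$ be a Hausdorff topological space. Let $CL(X)$ be the set of all nonempty closed subsets of $X$, and let $\tau_{locfin}$ be the locally finite topology on $CL(X)$, i.e. the topology having as a subbase all sets $V^{+}=\{A\in CL(X): A\subseteq V\}$ with $V$ open in $X$, and all sets $\mathcal U^{-}=\{A\in CL(X): A\cap U\neq\emptyset \text{ for every } U\in\mathcal U\}$ with $\mathcal U$ a locally finite family of open subsets of $X$. Let $NI(X)$ be the set of non-isolated points of $X$. A topological space $Y$ is called symmetrizable if there is a function $d:Y\times Y\to[0,\infty)$ with $d(x,y)=d(y,x)$ for all $x,y$, and $d(x,y)=0$ only if $x=y$, such that a set $U\subseteq Y$ is open if and only if for each $x\in U$ there is $\varepsilon>0$ with $\{y\in Y: d(x,y)<\varepsilon\}\subseteq U$. Then the following statements are equivalent: 1. $(CL(X),\tau_{locfin})$ is metrizable; 2. $(CL(X),\tau_{locfin})$ is symmetrizable; 3. $X$ is metrizable and $NI(X)$ is compact. -/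

import Mathlib

/-- `CL X`: the set of all nonempty closed subsets of `X`. -/
def CL (X : Type*) [TopologicalSpace X] : Type _ :=
  {A : Set X // IsClosed A ∧ A.Nonempty}

namespace CL

variable {X : Type*} [TopologicalSpace X]

/-- `V⁺`: the nonempty closed sets contained in `V`. -/
def upper (V : Set X) : Set (CL X) := {A | A.1 ⊆ V}

/-- `𝒰⁻`: the nonempty closed sets that meet every member of the family `𝒰`. -/
def lower (𝒰 : Set (Set X)) : Set (CL X) := {A | ∀ U ∈ 𝒰, (A.1 ∩ U).Nonempty}

/-- The locally finite topology on `CL X`: the topology with subbase all `V⁺`, for `V` open in `X`,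
and all `𝒰⁻`, for `𝒰` a locally finite family of open subsets of `X`. -/
abbrev locFinTopology (X : Type*) [TopologicalSpace X] : TopologicalSpace (CL X) :=
  TopologicalSpace.generateFrom
    ({S | ∃ V : Set X, IsOpen V ∧ S = upper V} ∪
      {S | ∃ 𝒰 : Set (Set X), (∀ U ∈ 𝒰, IsOpen U) ∧
        LocallyFinite (fun U : 𝒰 => (U : Set X)) ∧ S = lower 𝒰})

end CL

/-- `d` is a symmetric on `X`: a nonnegative symmetric function such that `d x y = 0` implies
`x = y`. (The values `d x x` have no influence on which sets are open in
`SymmetrizableSpace`.) -/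
structure IsSymmetric {X : Type*} (d : X → X → ℝ) : Prop where
  nonneg : ∀ x y, 0 ≤ d x y
  eq_of_eq_zero : ∀ x y, d x y = 0 → x = y
  symm : ∀ x y, d x y = d y x

/-- A topological space is symmetrizable if there is a symmetric `d` on it such that a set `U` is
open iff every `x ∈ U` has a ball `{y | d x y < ε}`, `ε > 0`, contained in `U`. -/
def SymmetrizableSpace (X : Type*) [TopologicalSpace X] : Prop :=
  ∃ d : X → X → ℝ, IsSymmetric d ∧
    ∀ U : Set X, IsOpen U ↔ ∀ x ∈ U, ∃ ε : ℝ, 0 < ε ∧ {y | d x y < ε} ⊆ U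

/-- `NI(X)`: the set of non-isolated points of `X`. -/
def nonIsolatedPoints (X : Type*) [TopologicalSpace X] : Set X := {x | ¬ IsOpen ({x} : Set X)}

/-!
Let `K` be the set of non-isolated points of `X`.

If `X` is metrizable and `K` is compact, then `X` has a compatible metric for which distinct points
are at least as far apart as each of them is from `K` (`IsGauge.exists_metricSpace`). For this
metric the locally finite topology is the topology of the Hausdorff distance
(`CL.isEmbedding_toCloseds`): near `K` compactness leaves only finitely many members of a locally
finite family to consider, and away from `K` small balls are singletons.

Conversely, let `d` be a symmetric for the hyperspace. Its balls need not be neighbourhoods of their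
centres, but a sequence with a unique cluster point `y` enters every ball around `y`
(`Symmetrizes.exists_lt_of_unique_cluster`). Four facts follow.

* A locally finite sequence of points expands to a locally finite sequence of open sets
  (`CL.expandable_univ`). Otherwise, on some subsequence, the trace of the topology on the sets of
  terms is the one with the intervals `[F, B]`, `F` finite, as neighbourhoods of `B`. Since
  the power set of `ℕ` contains a chain of the order type of the reals, that space is not
  symmetrizable, for a reason akin to the one for the Sorgenfrey line.
* If no term of such a sequence were isolated, perturbing them inside the expansion would give
  a closed set of perturbations with the original sequence in its closure
  (`CL.exists_isOpen_singleton`). So `K` is countably compact.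
* A family of closed sets in which decreasing sequences converge to their intersections has a
  minimal member (`CL.exists_forall_not_ssubset`), by the argument that shows that `ω₁` is not
  symmetrizable. Hence closed countably compact sets are hereditarily Lindelöf, and `K` is compact.
* The points of `K` are relative `Gδ`-sets, so the balls of the symmetric that `X` inherits as the
  closed subspace of singletons are relative neighbourhoods in `K`, and countably many Urysohn
  functions separate the points of `K` (`CL.exists_continuous_injOn`). The sets `K ∪ {x}` close to
  `K` provide a countable base of neighbourhoods of `K` (`CL.exists_isGauge`). Together these give a
  metric on `X`, again by `IsGauge.exists_metricSpace`.
-/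

open Set Filter Topology

/-! ### Symmetrizable spaces -/

/-- `d` is a symmetric on `Y` that determines its topology. -/
def Symmetrizes {Y : Type*} [TopologicalSpace Y] (d : Y → Y → ℝ) : Prop :=
  IsSymmetric d ∧ ∀ U : Set Y, IsOpen U ↔ ∀ x ∈ U, ∃ ε : ℝ, 0 < ε ∧ {y | d x y < ε} ⊆ U

namespace Symmetrizes

variable {Y : Type*} [TopologicalSpace Y] {d : Y → Y → ℝ}

theorem exists_ball (h : Symmetrizes d) {O : Set Y} (hO : IsOpen O) {y : Y} (hy : y ∈ O) :
    ∃ ε : ℝ, 0 < ε ∧ ∀ z, d y z < ε → z ∈ O :=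
  (h.2 O).1 hO y hy

theorem isClosed_of_separated (h : Symmetrizes d) {S : Set Y}
    (hS : ∀ z ∉ S, ∃ ε : ℝ, 0 < ε ∧ ∀ y ∈ S, ε ≤ d z y) : IsClosed S := by
  rw [← isOpen_compl_iff, h.2]
  intro z hz
  obtain ⟨ε, hε, hz⟩ := hS z hz
  exact ⟨ε, hε, fun y hy hyS => absurd (hz y hyS) (not_le.2 hy)⟩

theorem pos (h : Symmetrizes d) {x y : Y} (hxy : x ≠ y) : 0 < d x y :=
  lt_of_le_of_ne (h.1.nonneg x y) fun h0 => hxy (h.1.eq_of_eq_zero x y h0.symm)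

/-- Balls of a symmetric need not be neighbourhoods of their centres, but a sequence that clusters
at `y` and nowhere else does enter every ball around `y`: its range is not closed, and every point
at which the complement of the range fails to be open is a cluster point. -/
theorem exists_lt_of_unique_cluster (h : Symmetrizes d) {u : ℕ → Y} {y : Y}
    (hy : y ∉ range u) (hc : MapClusterPt y atTop u)
    (huniq : ∀ z, MapClusterPt z atTop u → z = y) {ε : ℝ} (hε : 0 < ε) :
    ∃ k, d y (u k) < ε := by
  have hnc : ¬ IsClosed (range u) := by
    intro hcl
    apply hy
    rw [← hcl.closure_eq, mem_closure_iff_nhds]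
    intro s hs
    obtain ⟨k, hk⟩ := ((mapClusterPt_iff_frequently.1 hc) s hs).exists
    exact ⟨u k, hk, mem_range_self k⟩
  have : ∃ z ∉ range u, ∀ δ : ℝ, 0 < δ → ∃ k, d z (u k) < δ := by
    by_contra! hcon
    apply hnc
    refine h.isClosed_of_separated fun z hz => ?_
    obtain ⟨δ, hδ, hk⟩ := hcon z hz
    refine ⟨δ, hδ, ?_⟩
    rintro _ ⟨k, rfl⟩
    exact hk k
  obtain ⟨z, hz, hzk⟩ := this
  have hzy : z = y := by
    refine huniq z (mapClusterPt_iff_frequently.2 fun s hs => ?_)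
    obtain ⟨O, hOs, hO, hzO⟩ := mem_nhds_iff.1 hs
    obtain ⟨δ, hδ, hball⟩ := h.exists_ball hO hzO
    rw [frequently_atTop]
    intro N
    have hfin : ∃ η : ℝ, 0 < η ∧ ∀ i < N, η ≤ d z (u i) := by
      induction N with
      | zero => exact ⟨1, one_pos, by simp⟩
      | succ N ih =>
        obtain ⟨η, hη, hi⟩ := ih
        have hp : 0 < d z (u N) := h.pos fun e => hz ⟨N, e.symm⟩
        refine ⟨min η (d z (u N)), lt_min hη hp, fun i hiN => ?_⟩
        rcases Nat.lt_succ_iff_lt_or_eq.1 hiN with hlt | rfl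
        · exact (min_le_left _ _).trans (hi i hlt)
        · exact min_le_right _ _
    obtain ⟨η, hη, hi⟩ := hfin
    obtain ⟨k, hk⟩ := hzk (min δ η) (lt_min hδ hη)
    refine ⟨k, ?_, hOs (hball _ (hk.trans_le (min_le_left _ _)))⟩
    by_contra! hkN
    exact absurd (hi k hkN) (not_le.2 (hk.trans_le (min_le_right _ _)))
  subst hzy
  exact hzk ε hε

theorem of_isClosedEmbedding (h : Symmetrizes d) {X : Type*} [TopologicalSpace X] {f : X → Y}
    (hf : IsClosedEmbedding f) : Symmetrizes fun x y => d (f x) (f y) := by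
  refine ⟨⟨fun _ _ => h.1.nonneg _ _, fun _ _ h0 => hf.injective (h.1.eq_of_eq_zero _ _ h0),
    fun _ _ => h.1.symm _ _⟩, fun U => ⟨fun hU x hx => ?_, fun hU => ?_⟩⟩
  · obtain ⟨O, hO, rfl⟩ := hf.isInducing.isOpen_iff.1 hU
    obtain ⟨ε, hε, hb⟩ := h.exists_ball hO hx
    exact ⟨ε, hε, fun y hy => hb _ hy⟩
  · have hO : IsOpen (f '' U ∪ (range f)ᶜ) := by
      rw [h.2]
      rintro z (⟨x, hx, rfl⟩ | hz)
      · obtain ⟨ε, hε, hb⟩ := hU x hx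
        refine ⟨ε, hε, fun y hy => ?_⟩
        by_cases hyr : y ∈ range f
        · obtain ⟨w, rfl⟩ := hyr
          exact Or.inl ⟨w, hb hy, rfl⟩
        · exact Or.inr hyr
      · obtain ⟨ε, hε, hb⟩ := h.exists_ball hf.isClosed_range.isOpen_compl hz
        exact ⟨ε, hε, fun y hy => Or.inr (hb y hy)⟩
    have : U = f ⁻¹' (f '' U ∪ (range f)ᶜ) := by
      ext x
      simp [hf.injective.mem_set_image]
    rw [this]
    exact hO.preimage hf.continuous

end Symmetrizes

theorem SymmetrizableSpace.of_metrizableSpace (Y : Type*) [TopologicalSpace Y]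
    [TopologicalSpace.MetrizableSpace Y] : SymmetrizableSpace Y := by
  let := TopologicalSpace.metrizableSpaceMetric Y
  refine ⟨dist, ⟨fun _ _ => dist_nonneg, fun _ _ => eq_of_dist_eq_zero, dist_comm⟩, fun U => ?_⟩
  rw [Metric.isOpen_iff]
  refine forall₂_congr fun x _ => exists_congr fun ε => and_congr Iff.rfl ?_
  have : Metric.ball x ε = {y | dist x y < ε} := by
    ext y
    rw [Metric.mem_ball, dist_comm, mem_ofPred_eq]
  rw [this]

/-! ### The hyperspace of nonempty closed sets -/

namespace CL

variable {X : Type*} [TopologicalSpace X]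

instance instTopologicalSpace : TopologicalSpace (CL X) := locFinTopology X

theorem isOpen_upper {V : Set X} (hV : IsOpen V) : IsOpen (upper V) :=
  TopologicalSpace.isOpen_generateFrom_of_mem (Or.inl ⟨V, hV, rfl⟩)

theorem isOpen_lower {𝒰 : Set (Set X)} (h𝒰 : ∀ U ∈ 𝒰, IsOpen U)
    (hlf : LocallyFinite fun U : 𝒰 => (U : Set X)) : IsOpen (lower 𝒰) :=
  TopologicalSpace.isOpen_generateFrom_of_mem (Or.inr ⟨𝒰, h𝒰, hlf, rfl⟩)

theorem isOpen_lower_range {ι : Type*} {U : ι → Set X} (hU : ∀ i, IsOpen (U i))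
    (hlf : LocallyFinite U) : IsOpen {A : CL X | ∀ i, (A.1 ∩ U i).Nonempty} := by
  have : {A : CL X | ∀ i, (A.1 ∩ U i).Nonempty} = lower (range U) := by
    ext A
    simp [lower]
  rw [this]
  exact isOpen_lower (by rintro _ ⟨i, rfl⟩; exact hU i) hlf.on_range

theorem isOpen_hit {U : Set X} (hU : IsOpen U) : IsOpen {A : CL X | (A.1 ∩ U).Nonempty} := by
  have := isOpen_lower_range (U := fun _ : Unit => U) (fun _ => hU) (locallyFinite_of_finite _)
  simpa using this

theorem isClosed_setOf_subset {S : Set X} (hS : IsClosed S) : IsClosed {A : CL X | A.1 ⊆ S} := by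
  rw [← isOpen_compl_iff]
  convert isOpen_hit hS.isOpen_compl using 1
  ext A
  simp [Set.not_subset, Set.Nonempty]

/-- A property of sets of closed sets that is monotone and stable under intersections holds for all
open sets containing `A` once it holds for the subbasic ones. -/
theorem nhds_induction {A : CL X} {p : Set (CL X) → Prop} (huniv : p univ)
    (hmono : ∀ O O', O ⊆ O' → p O → p O') (hinter : ∀ O O', p O → p O' → p (O ∩ O'))
    (hupper : ∀ V : Set X, IsOpen V → A.1 ⊆ V → p (upper V))
    (hlower : ∀ 𝒰 : Set (Set X), (∀ U ∈ 𝒰, IsOpen U) →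
      LocallyFinite (fun U : 𝒰 => (U : Set X)) → A ∈ lower 𝒰 → p (lower 𝒰))
    {O : Set (CL X)} (hO : IsOpen O) (hA : A ∈ O) : p O := by
  induction hO with
  | basic S hS =>
    rcases hS with ⟨V, hV, rfl⟩ | ⟨𝒰, h𝒰, hlf, rfl⟩
    · exact hupper V hV hA
    · exact hlower 𝒰 h𝒰 hlf hA
  | univ => exact huniv
  | inter S T _ _ ihS ihT => exact hinter S T (ihS hA.1) (ihT hA.2)
  | sUnion 𝒮 _ ih =>
    obtain ⟨S, hS, hAS⟩ := hA
    exact hmono S _ (subset_sUnion_of_mem hS) (ih S hS hAS)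

variable [T2Space X]

/-- The closed set `A ∪ {x}`; for `A ⊆ {x}` this is the singleton of `x`. -/
def insertPt (A : Set X) (hA : IsClosed A) (x : X) : CL X :=
  ⟨insert x A, by rw [insert_eq]; exact isClosed_singleton.union hA, insert_nonempty x A⟩

theorem continuous_insertPt (A : Set X) (hA : IsClosed A) : Continuous (insertPt A hA) := by
  refine continuous_generateFrom_iff.2 ?_
  rintro S (⟨V, hV, rfl⟩ | ⟨𝒰, h𝒰, hlf, rfl⟩)
  · by_cases hAV : A ⊆ V
    · convert hV using 1
      ext x
      simp [upper, insertPt, insert_subset_iff, hAV]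
    · convert isOpen_empty using 1
      ext x
      simp [upper, insertPt, insert_subset_iff, hAV]
  · rw [isOpen_iff_forall_mem_open]
    intro x hx
    -- only the finitely many members that contain `x` constrain the moving point
    have hfin : {U : 𝒰 | x ∈ (U : Set X)}.Finite := hlf.point_finite x
    refine ⟨⋂ U ∈ {U : 𝒰 | x ∈ (U : Set X)}, (U : Set X), ?_,
      hfin.isOpen_biInter fun U _ => h𝒰 U U.2, by simp⟩
    intro y hy U hU
    obtain ⟨a, ha, haU⟩ := hx U hU
    rcases ha with rfl | ha
    · exact ⟨y, Or.inl rfl, mem_iInter₂.1 hy ⟨U, hU⟩ haU⟩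
    · exact ⟨a, Or.inr ha, haU⟩

theorem isClosedEmbedding_singleton : IsClosedEmbedding (insertPt (∅ : Set X) isClosed_empty) := by
  have hinj : Function.Injective (insertPt (∅ : Set X) isClosed_empty) := by
    intro x y hxy
    have := congrArg Subtype.val hxy
    simpa [insertPt] using this
  refine ⟨⟨⟨le_antisymm (continuous_insertPt _ _).le_induced ?_⟩, hinj⟩, ?_⟩
  · intro U hU
    refine ⟨upper U, isOpen_upper hU, ?_⟩
    ext x
    simp [upper, insertPt]
  · rw [← isOpen_compl_iff, isOpen_iff_forall_mem_open]
    intro A hA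
    obtain ⟨a, ha⟩ := A.2.2
    have : ∃ b ∈ A.1, b ≠ a := by
      by_contra! hcon
      refine hA ⟨a, Subtype.ext ?_⟩
      ext z
      simp only [insertPt, insert_empty_eq, mem_singleton_iff]
      exact ⟨fun h => h ▸ ha, hcon z⟩
    obtain ⟨b, hb, hba⟩ := this
    obtain ⟨U, V, hU, hV, haU, hbV, hUV⟩ := t2_separation hba.symm
    refine ⟨_, ?_, (isOpen_hit hU).inter (isOpen_hit hV), ⟨a, ha, haU⟩, ⟨b, hb, hbV⟩⟩
    rintro B ⟨⟨p, hp, hpU⟩, ⟨q, hq, hqV⟩⟩ ⟨x, rfl⟩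
    simp only [insertPt, insert_empty_eq, mem_singleton_iff] at hp hq
    subst hp hq
    exact disjoint_left.1 hUV hpU hqV

end CL

/-! ### Decreasing families of closed sets and countable compactness -/

namespace CL

variable {X : Type*} [TopologicalSpace X]

theorem mapClusterPt_of_antitone {u : ℕ → CL X} {H : ℕ → Set X} {L : CL X}
    (hLu : ∀ j, L.1 ⊆ (u j).1) (huH : ∀ j, (u j).1 ⊆ H j) (hH : Antitone H)
    (hV : ∀ V : Set X, IsOpen V → L.1 ⊆ V → ∃ i, H i ⊆ V) : MapClusterPt L atTop u := by
  refine Tendsto.mapClusterPt fun s hs => ?_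
  obtain ⟨O, hOs, hO, hLO⟩ := mem_nhds_iff.1 hs
  suffices ∀ᶠ j in atTop, u j ∈ O from this.mono fun j hj => hOs hj
  refine nhds_induction (p := fun O => ∀ᶠ j in atTop, u j ∈ O) (by simp)
    (fun O O' hOO' h => h.mono fun j hj => hOO' hj) (fun O O' h h' => h.and h') ?_ ?_ hO hLO
  · intro V hVo hLV
    obtain ⟨i, hi⟩ := hV V hVo hLV
    filter_upwards [eventually_ge_atTop i] with j hj
    exact (huH j).trans ((hH hj).trans hi)
  · intro 𝒰 _ _ hL
    exact Eventually.of_forall fun j U hU => (hL U hU).mono (inter_subset_inter_left _ (hLu j))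

theorem eq_of_mapClusterPt_of_antitone [T1Space X] {u : ℕ → CL X} {H : ℕ → Set X} {L z : CL X}
    (hLu : ∀ j, L.1 ⊆ (u j).1) (huH : ∀ j, (u j).1 ⊆ H j) (hH : Antitone H)
    (hHc : ∀ i, IsClosed (H i)) (hL : L.1 = ⋂ i, H i) (hz : MapClusterPt z atTop u) : z = L := by
  rw [mapClusterPt_iff_frequently] at hz
  refine Subtype.ext (Subset.antisymm (fun c hc => ?_) fun x hx => ?_)
  · rw [hL, mem_iInter]
    by_contra! hcon
    obtain ⟨i, hi⟩ := hcon
    have hf := hz _ ((isOpen_hit (hHc i).isOpen_compl).mem_nhds ⟨c, hc, hi⟩)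
    obtain ⟨j, hj, a, ha, hai⟩ := frequently_atTop.1 hf i
    exact hai (hH hj (huH j ha))
  · by_contra hxz
    have hf := hz _ ((isOpen_upper (isOpen_compl_singleton (x := x))).mem_nhds
      (subset_compl_singleton_iff.2 hxz))
    obtain ⟨j, hj⟩ := hf.exists
    exact hj (hLu j hx) rfl

/-- A nonempty family of closed sets in which decreasing sequences converge to their intersection
has a minimal member. This is the argument that `ω₁` is not symmetrizable, with
the pressing-down lemma replaced by a sequence that visits every cofinal member of a countable
partition infinitely often. -/
theorem exists_forall_not_ssubset [T1Space X] {d : CL X → CL X → ℝ} (h : Symmetrizes d)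
    {𝓕 : Set (CL X)} (hne : 𝓕.Nonempty)
    (hlim : ∀ H : ℕ → CL X, (∀ i, H i ∈ 𝓕) → Antitone (fun i => (H i).1) →
      ∃ L ∈ 𝓕, L.1 = ⋂ i, (H i).1 ∧ ∀ V : Set X, IsOpen V → L.1 ⊆ V → ∃ i, (H i).1 ⊆ V) :
    ∃ F ∈ 𝓕, ∀ G ∈ 𝓕, ¬ G.1 ⊂ F.1 := by
  by_contra! hdec
  -- the sets not contained in the smaller member `G` form a neighbourhood of `F`
  have key : ∀ F : 𝓕, ∃ G : 𝓕, ∃ m : ℕ, G.1.1 ⊂ F.1.1 ∧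
      ∀ B : CL X, d F.1 B < 1 / ((m : ℝ) + 1) → ¬ B.1 ⊆ G.1.1 := by
    rintro ⟨F, hF⟩
    obtain ⟨G, hG, hGF⟩ := hdec F hF
    obtain ⟨x, hxF, hxG⟩ := exists_of_ssubset hGF
    obtain ⟨ε, hε, hb⟩ := h.exists_ball (isOpen_hit G.2.1.isOpen_compl)
      (show F ∈ {A : CL X | (A.1 ∩ G.1ᶜ).Nonempty} from ⟨x, hxF, hxG⟩)
    obtain ⟨m, hm⟩ := exists_nat_one_div_lt hε
    refine ⟨⟨G, hG⟩, m, hGF, fun B hB hBG => ?_⟩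
    obtain ⟨y, hyB, hyG⟩ := hb B (hB.trans hm)
    exact hyG (hBG hyB)
  choose G m hG hm using key
  classical
  let step : ℕ → 𝓕 → 𝓕 := fun k H =>
    if hk : ∃ F : 𝓕, m F = k ∧ F.1.1 ⊆ H.1.1 then G hk.choose else H
  have hstep : ∀ k H, (step k H).1.1 ⊆ H.1.1 := by
    intro k H
    by_cases hk : ∃ F : 𝓕, m F = k ∧ F.1.1 ⊆ H.1.1
    · simp only [step, dif_pos hk]
      exact (hG _).subset.trans hk.choose_spec.2
    · simp only [step, dif_neg hk]
      exact Subset.rfl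
  let H : ℕ → 𝓕 := fun n => Nat.rec ⟨hne.some, hne.some_mem⟩ (fun i H => step (Nat.unpair i).1 H) n
  have hHs : ∀ i, H (i + 1) = step (Nat.unpair i).1 (H i) := fun i => rfl
  have hH : Antitone fun i => (H i).1.1 := antitone_nat_of_succ_le fun i => by
    rw [hHs]
    exact hstep _ _
  obtain ⟨L, hL, hLH, hV⟩ := hlim (fun i => (H i).1) (fun i => (H i).2) hH
  have hLi : ∀ i, L.1 ⊆ (H i).1.1 := fun i => hLH ▸ iInter_subset _ i
  set μ := m ⟨L, hL⟩ with hμ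
  have hu : ∀ j, ∃ F : 𝓕, m F = μ ∧ F.1.1 ⊆ (H j).1.1 ∧ L.1 ⊆ (G F).1.1 := by
    intro j
    have hk : ∃ F : 𝓕, m F = μ ∧ F.1.1 ⊆ (H (Nat.pair μ j)).1.1 := ⟨⟨L, hL⟩, rfl, hLi _⟩
    have hs : H (Nat.pair μ j + 1) = G hk.choose := by
      rw [hHs, Nat.unpair_pair]
      simp only [step, dif_pos hk]
    refine ⟨hk.choose, hk.choose_spec.1, ?_, by rw [← hs]; exact hLi (Nat.pair μ j + 1)⟩
    exact hk.choose_spec.2.trans (hH (Nat.right_le_pair μ j))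
  choose u hum huH hLG using hu
  have hLu : ∀ j, L.1 ⊆ (u j).1.1 := fun j => (hLG j).trans (hG _).subset
  obtain ⟨j, hj⟩ := h.exists_lt_of_unique_cluster (u := fun j => (u j).1) (y := L) (ε := 1 / (μ + 1))
    (by
      rintro ⟨j, hj⟩
      refine (hG (u j)).not_subset ?_
      have := hLG j
      rwa [← hj] at this)
    (mapClusterPt_of_antitone hLu huH hH hV)
    (fun z hz => eq_of_mapClusterPt_of_antitone hLu huH hH (fun i => (H i).1.2.1) hLH hz)
    (by positivity)
  rw [h.1.symm, ← hum j] at hj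
  exact hm _ _ hj (hLG j)

/-- Closed countably compact subsets are hereditarily Lindelöf: otherwise the sets left uncovered by
countable subfamilies form a family of closed sets with no minimal member. -/
theorem exists_countable_subcover [T1Space X] {d : CL X → CL X → ℝ} (h : Symmetrizes d)
    {K : Set X} (hK : IsClosed K) (hKc : IsCountablyCompact K) {𝒱 : Set (Set X)}
    (h𝒱 : ∀ V ∈ 𝒱, IsOpen V) : ∃ 𝒞 ⊆ 𝒱, 𝒞.Countable ∧ K ∩ ⋃₀ 𝒱 ⊆ ⋃₀ 𝒞 := by
  by_contra! hcon
  have hx : ∀ 𝒞 ⊆ 𝒱, 𝒞.Countable → ∃ x ∈ K, x ∈ ⋃₀ 𝒱 ∧ x ∉ ⋃₀ 𝒞 := by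
    intro 𝒞 h𝒞 hc
    obtain ⟨x, ⟨hxK, hxV⟩, hx⟩ := not_subset.1 (hcon 𝒞 h𝒞 hc)
    exact ⟨x, hxK, hxV, hx⟩
  let F : ∀ 𝒞 : Set (Set X), 𝒞 ⊆ 𝒱 → 𝒞.Countable → CL X := fun 𝒞 h𝒞 hc =>
    ⟨K \ ⋃₀ 𝒞, hK.sdiff (isOpen_sUnion fun V hV => h𝒱 V (h𝒞 hV)), by
      obtain ⟨x, hxK, -, hx⟩ := hx 𝒞 h𝒞 hc
      exact ⟨x, hxK, hx⟩⟩
  obtain ⟨A, ⟨𝒞, h𝒞, hc, rfl⟩, hmin⟩ := exists_forall_not_ssubset h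
    (𝓕 := {A | ∃ 𝒞, ∃ (h𝒞 : 𝒞 ⊆ 𝒱) (hc : 𝒞.Countable), F 𝒞 h𝒞 hc = A})
    ⟨_, ∅, empty_subset _, countable_empty, rfl⟩ (by
      intro H hH hanti
      choose C hC hCc hHC using hH
      have hHi : ∀ i, (H i).1 = K \ ⋃₀ C i := fun i => by rw [← hHC i]
      refine ⟨_, ⟨⋃ i, C i, iUnion_subset hC, countable_iUnion hCc, rfl⟩, ?_, ?_⟩
      · ext x
        simp only [F, hHi, mem_iInter, Set.mem_sdiff, mem_sUnion, mem_iUnion]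
        constructor
        · rintro ⟨hxK, hx⟩ i
          exact ⟨hxK, fun ⟨V, hV, hxV⟩ => hx ⟨V, ⟨i, hV⟩, hxV⟩⟩
        · intro hx
          exact ⟨(hx 0).1, fun ⟨V, ⟨i, hV⟩, hxV⟩ => (hx i).2 ⟨V, hV, hxV⟩⟩
      · intro V hV hLV
        obtain ⟨i, hi⟩ := hKc.elim_directed_cover (fun i => V ∪ (H i).1ᶜ)
          (fun i => hV.union (H i).2.1.isOpen_compl) (by
            intro x hxK
            rw [mem_iUnion]
            by_contra! hcon'
            have hxH : ∀ i, x ∈ K \ ⋃₀ C i := fun i => by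
              rw [← hHi]
              by_contra hxi
              exact hcon' i (Or.inr hxi)
            refine hcon' 0 (Or.inl (hLV ⟨hxK, ?_⟩))
            rintro ⟨W, hW, hxW⟩
            obtain ⟨i, hi⟩ := mem_iUnion.1 hW
            exact (hxH i).2 ⟨W, hi, hxW⟩)
          (Monotone.directed_le fun i j hij =>
            union_subset_union_right _ (compl_subset_compl.2 (hanti hij)))
        refine ⟨i, fun x hx => ?_⟩
        have hxK : x ∈ K := by
          rw [hHi] at hx
          exact hx.1
        exact (hi hxK).resolve_right fun hn => hn hx)
  obtain ⟨x, hxK, ⟨V, hV, hxV⟩, hxC⟩ := hx 𝒞 h𝒞 hc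
  refine hmin _ ⟨insert V 𝒞, insert_subset hV h𝒞, hc.insert V, rfl⟩ ?_
  refine ⟨sdiff_subset_sdiff_right (sUnion_subset_sUnion (subset_insert _ _)), fun hsub => ?_⟩
  exact (hsub (show x ∈ K \ ⋃₀ 𝒞 from ⟨hxK, hxC⟩)).2 ⟨V, mem_insert _ _, hxV⟩

theorem isCompact_of_isCountablyCompact [T1Space X] {d : CL X → CL X → ℝ} (h : Symmetrizes d)
    {K : Set X} (hK : IsClosed K) (hKc : IsCountablyCompact K) : IsCompact K := by
  refine isCompact_of_finite_subcover fun {ι} U hU hKU => ?_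
  obtain ⟨𝒞, h𝒞, hc, hsub⟩ := exists_countable_subcover h hK hKc (𝒱 := range U)
    (by rintro _ ⟨i, rfl⟩; exact hU i)
  obtain ⟨t, ht, htf, hKt⟩ := hKc.elim_finite_subcover_image hc (U := id)
    (fun V hV => by obtain ⟨i, rfl⟩ := h𝒞 hV; exact hU i)
    (fun x hx => by
      obtain ⟨V, hV, hxV⟩ := hsub ⟨hx, by simpa using hKU hx⟩
      exact mem_biUnion hV hxV)
  choose i hi using fun V : t => h𝒞 (ht V.2)
  have := htf.fintype
  classical
  refine ⟨Finset.univ.image i, fun x hx => ?_⟩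
  obtain ⟨V, hV, hxV⟩ := mem_iUnion₂.1 (hKt hx)
  exact mem_biUnion (show i ⟨V, hV⟩ ∈ Finset.univ.image i from
    Finset.mem_image_of_mem i (Finset.mem_univ _)) (by rw [hi ⟨V, hV⟩]; exact hxV)

end CL

/-! ### Locally finite sequences of points and their expansions -/

namespace CL

variable {X : Type*} [TopologicalSpace X] {x : ℕ → X}

/-- The set `E` of indices is expandable for the sequence `x` if the points `x n`, `n ∈ E`, have
open neighbourhoods forming a locally finite family. (The members with index outside `E` are
unconstrained and may be empty.) -/
def Expandable (x : ℕ → X) (E : Set ℕ) : Prop :=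
  ∃ U : ℕ → Set X, (∀ n, IsOpen (U n)) ∧ LocallyFinite U ∧ ∀ n ∈ E, x n ∈ U n

theorem Expandable.union {E E' : Set ℕ} (h : Expandable x E) (h' : Expandable x E') :
    Expandable x (E ∪ E') := by
  obtain ⟨U, hU, hlf, hE⟩ := h
  obtain ⟨U', hU', hlf', hE'⟩ := h'
  refine ⟨fun n => U n ∪ U' n, fun n => (hU n).union (hU' n), fun z => ?_, ?_⟩
  · obtain ⟨t, ht, hf⟩ := hlf z
    obtain ⟨t', ht', hf'⟩ := hlf' z
    refine ⟨t ∩ t', inter_mem ht ht', (hf.union hf').subset ?_⟩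
    rintro n ⟨y, hy | hy, hyt, hyt'⟩
    · exact Or.inl ⟨y, hy, hyt⟩
    · exact Or.inr ⟨y, hy, hyt'⟩
  · rintro n (hn | hn)
    · exact Or.inl (hE n hn)
    · exact Or.inr (hE' n hn)

theorem expandable_of_finite {E : Set ℕ} (hE : E.Finite) : Expandable x E := by
  classical
  refine ⟨fun n => if n ∈ E then univ else ∅, fun n => ?_, fun z => ⟨univ, univ_mem, ?_⟩, ?_⟩
  · dsimp only
    split_ifs
    exacts [isOpen_univ, isOpen_empty]
  · refine hE.subset fun n hn => ?_
    by_contra hnE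
    simp [hnE] at hn
  · intro n hn
    simp [hn]

theorem Expandable.of_comp {φ : ℕ → ℕ} (hφ : Function.Injective φ) {E : Set ℕ}
    (h : Expandable (x ∘ φ) E) : Expandable x (φ '' E) := by
  obtain ⟨U, hU, hlf, hE⟩ := h
  refine ⟨Function.extend φ U fun _ => ∅, fun n => ?_, fun z => ?_, ?_⟩
  · by_cases hn : ∃ k, φ k = n
    · obtain ⟨k, rfl⟩ := hn
      rw [hφ.extend_apply]
      exact hU k
    · rw [Function.extend_apply' _ _ _ hn]
      exact isOpen_empty
  · obtain ⟨t, ht, hf⟩ := hlf z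
    refine ⟨t, ht, (hf.image φ).subset fun n hn => ?_⟩
    by_cases hk : ∃ k, φ k = n
    · obtain ⟨k, rfl⟩ := hk
      rw [mem_ofPred_eq, hφ.extend_apply] at hn
      exact ⟨k, hn, rfl⟩
    · rw [mem_ofPred_eq, Function.extend_apply' _ _ _ hk] at hn
      simp at hn
  · rintro _ ⟨k, hk, rfl⟩
    rw [hφ.extend_apply]
    exact hE k hk

section

variable [T1Space X]

theorem isClosed_image_of_locallyFinite (hlf : LocallyFinite fun n => ({x n} : Set X))
    (B : Set ℕ) : IsClosed (x '' B) := by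
  have : x '' B = ⋃ n : B, {x n} := by
    ext y
    simp [eq_comm]
  rw [this]
  exact (hlf.comp_injective Subtype.val_injective).isClosed_iUnion fun _ => isClosed_singleton

/-- The closed set `{x n | n ∈ B}`, for a locally finite sequence of points `x`. -/
def image (hlf : LocallyFinite fun n => ({x n} : Set X)) (B : Set ℕ) (hB : B.Nonempty) : CL X :=
  ⟨x '' B, isClosed_image_of_locallyFinite hlf B, hB.image x⟩

/-- Among the subsets of `{x n | n ∈ B}`, the order intervals whose lower end is expandable are
neighbourhoods of the upper end `{x n | n ∈ B}`. -/
theorem exists_interval_subset (hlf : LocallyFinite fun n => ({x n} : Set X))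
    {B : Set ℕ} {hB : B.Nonempty} {O : Set (CL X)} (hO : IsOpen O)
    (hBO : image hlf B hB ∈ O) : ∃ E ⊆ B, Expandable x E ∧
      ∀ C, ∀ hC : C.Nonempty, E ⊆ C → C ⊆ B → image hlf C hC ∈ O := by
  refine nhds_induction (A := image hlf B hB) (p := fun O => ∃ E ⊆ B, Expandable x E ∧
      ∀ C, ∀ hC : C.Nonempty, E ⊆ C → C ⊆ B → image hlf C hC ∈ O) ?_ ?_ ?_ ?_ ?_ hO hBO
  · exact ⟨∅, empty_subset _, expandable_of_finite finite_empty, fun _ _ _ _ => mem_univ _⟩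
  · rintro O O' hOO' ⟨E, hEB, hE, h⟩
    exact ⟨E, hEB, hE, fun C hC hEC hCB => hOO' (h C hC hEC hCB)⟩
  · rintro O O' ⟨E, hEB, hE, h⟩ ⟨E', hEB', hE', h'⟩
    exact ⟨E ∪ E', union_subset hEB hEB', hE.union hE', fun C hC hEC hCB =>
      ⟨h C hC (subset_union_left.trans hEC) hCB, h' C hC (subset_union_right.trans hEC) hCB⟩⟩
  · intro V _ hBV
    exact ⟨∅, empty_subset _, expandable_of_finite finite_empty, fun C hC _ hCB =>
      (image_mono hCB).trans hBV⟩
  · intro 𝒰 h𝒰 h𝒰lf hB𝒰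
    have hn : ∀ U : 𝒰, ∃ n ∈ B, x n ∈ (U : Set X) := by
      intro U
      obtain ⟨_, ⟨n, hn, rfl⟩, hnU⟩ := hB𝒰 U U.2
      exact ⟨n, hn, hnU⟩
    choose N hNB hNU using hn
    -- each chosen index keeps just one of the sets that selected it
    have hsel : ∀ n : range N, ∃ U : 𝒰, N U = n := fun n => n.2
    choose s hs using hsel
    have hsinj : Function.Injective s := fun a b hab => Subtype.ext (by rw [← hs a, ← hs b, hab])
    refine ⟨range N, by rintro _ ⟨U, rfl⟩; exact hNB U, ?_, ?_⟩
    · classical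
      refine ⟨fun n => if hn : n ∈ range N then (s ⟨n, hn⟩ : Set X) else ∅, fun n => ?_,
        fun z => ?_, ?_⟩
      · dsimp only
        split_ifs with hn
        exacts [h𝒰 _ (s ⟨n, hn⟩).2, isOpen_empty]
      · obtain ⟨t, ht, hf⟩ := (h𝒰lf.comp_injective hsinj) z
        refine ⟨t, ht, (hf.image Subtype.val).subset fun n hn => ?_⟩
        by_cases hnN : n ∈ range N
        · rw [mem_ofPred_eq] at hn
          simp only [dif_pos hnN] at hn
          exact ⟨⟨n, hnN⟩, hn, rfl⟩
        · rw [mem_ofPred_eq] at hn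
          simp only [dif_neg hnN] at hn
          simp at hn
      · intro n hn
        simp only [dif_pos hn]
        have := hNU (s ⟨n, hn⟩)
        rwa [hs] at this
    · intro C hC hNC _ U hU
      exact ⟨x (N ⟨U, hU⟩), ⟨_, hNC (mem_range_self _), rfl⟩, hNU ⟨U, hU⟩⟩

theorem exists_isOpen_subset_of_expandable (hlf : LocallyFinite fun n => ({x n} : Set X))
    (hx : Function.Injective x) {E B : Set ℕ} (hE : Expandable x E) (hEB : E ⊆ B)
    (hB : B.Nonempty) : ∃ O : Set (CL X), IsOpen O ∧ image hlf B hB ∈ O ∧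
      ∀ C hC, image hlf C hC ∈ O → E ⊆ C := by
  obtain ⟨U, hU, hUlf, hxU⟩ := hE
  refine ⟨{A | ∀ n : E, (A.1 ∩ (U n \ x '' {n.1}ᶜ)).Nonempty},
    isOpen_lower_range (fun n => (hU n).sdiff (isClosed_image_of_locallyFinite hlf _))
      ((hUlf.comp_injective Subtype.val_injective).subset fun n => sdiff_subset), ?_, ?_⟩
  · intro n
    refine ⟨x n, ⟨n, hEB n.2, rfl⟩, hxU n n.2, ?_⟩
    rintro ⟨m, hm, hmn⟩
    exact hm (hx hmn)
  · intro C hC hCO n hn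
    obtain ⟨_, ⟨m, hm, rfl⟩, -, hmn⟩ := hCO ⟨n, hn⟩
    have : m = n := by
      by_contra hne
      exact hmn ⟨m, hne, rfl⟩
    exact this ▸ hm

theorem exists_eq_image_of_subset (hlf : LocallyFinite fun n => ({x n} : Set X))
    (hx : Function.Injective x) {A : CL X} {B : Set ℕ} (hA : A.1 ⊆ x '' B) :
    ∃ C, ∃ hC : C.Nonempty, C ⊆ B ∧ A = image hlf C hC := by
  have hAC : x '' (x ⁻¹' A.1) = A.1 :=
    image_preimage_eq_of_subset (hA.trans (image_subset_range _ _))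
  refine ⟨x ⁻¹' A.1, ?_, ?_, Subtype.ext hAC.symm⟩
  · rw [← image_nonempty (f := x), hAC]
    exact A.2.2
  · rwa [← hx.injOn.image_subset_image_iff (subset_univ _) (subset_univ _), hAC]

/-- If a locally finite sequence of points is not expandable, then the proper subsets of its range
approach the range along a sequence, and choosing one missing point from each of them
gives a subsequence that is not expandable along any infinite set. -/
theorem exists_infinite_forall_expandable_finite
    (hlf : LocallyFinite fun n => ({x n} : Set X)) (hx : Function.Injective x)
    {d : CL X → CL X → ℝ} (h : Symmetrizes d)
    (hne : ¬ Expandable x univ) :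
    ∃ J : Set ℕ, J.Infinite ∧ ∀ E ⊆ J, Expandable x E → E.Finite := by
  have hclose : ∀ ε : ℝ, 0 < ε → ∃ C, ∃ hC : C.Nonempty, C ≠ univ ∧
      d (image hlf univ univ_nonempty) (image hlf C hC) < ε := by
    by_contra! hcon
    obtain ⟨ε, hε, hcon⟩ := hcon
    have hcl : IsClosed {A | ∃ C, ∃ hC : C.Nonempty, C ≠ univ ∧ A = image hlf C hC} := by
      refine h.isClosed_of_separated fun z hz => ?_
      by_cases hzx : z.1 ⊆ x '' univ
      · obtain ⟨C, hC, -, rfl⟩ := exists_eq_image_of_subset hlf hx hzx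
        have hCu : C = univ := by
          by_contra hCu
          exact hz ⟨C, hC, hCu, rfl⟩
        subst hCu
        refine ⟨ε, hε, ?_⟩
        rintro _ ⟨C', hC', hne', rfl⟩
        exact hcon C' hC' hne'
      · obtain ⟨δ, hδ, hb⟩ := h.exists_ball
          (isClosed_setOf_subset (isClosed_image_of_locallyFinite hlf univ)).isOpen_compl hzx
        refine ⟨δ, hδ, ?_⟩
        rintro _ ⟨C', hC', -, rfl⟩
        by_contra! hlt
        exact hb _ hlt (image_mono (subset_univ _))
    have huniv : image hlf univ univ_nonempty ∉
        {A | ∃ C, ∃ hC : C.Nonempty, C ≠ univ ∧ A = image hlf C hC} := by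
      rintro ⟨C, hC, hCu, he⟩
      exact hCu (hx.image_injective (congrArg Subtype.val he)).symm
    obtain ⟨E, -, hE, hEO⟩ := exists_interval_subset hlf hcl.isOpen_compl huniv
    obtain ⟨b, hb⟩ : ∃ b, b ∉ E := by
      by_contra! hall
      exact hne (eq_univ_of_forall hall ▸ hE)
    refine hEO {b}ᶜ ⟨b + 1, by simp⟩ (subset_compl_singleton_iff.2 hb) (subset_univ _)
      ⟨_, _, ?_, rfl⟩
    exact fun he => (he ▸ mem_univ b : b ∈ ({b}ᶜ : Set ℕ)) rfl
  choose C hC hCu hCd using fun k : ℕ => hclose (1 / ((k : ℝ) + 1)) (by positivity)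
  have hmiss : ∀ k, ∃ e, e ∉ C k := fun k => by
    by_contra! hall
    exact hCu k (eq_univ_of_forall hall)
  choose e he using hmiss
  have hev : ∀ E, Expandable x E → ∃ N, ∀ k, N ≤ k → e k ∉ E := by
    intro E hE
    obtain ⟨O, hO, hxO, hOE⟩ :=
      exists_isOpen_subset_of_expandable hlf hx hE (subset_univ _) univ_nonempty
    obtain ⟨ε, hε, hb⟩ := h.exists_ball hO hxO
    obtain ⟨N, hN⟩ := exists_nat_one_div_lt hε
    refine ⟨N, fun k hk hkE => he k (hOE _ (hC k) (hb _ ?_) hkE)⟩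
    exact (hCd k).trans ((Nat.one_div_le_one_div hk).trans_lt hN)
  refine ⟨range e, fun hfin => ?_, fun E hEJ hE => ?_⟩
  · obtain ⟨N, hN⟩ := hev _ (expandable_of_finite hfin)
    exact hN N le_rfl (mem_range_self N)
  · obtain ⟨N, hN⟩ := hev E hE
    refine ((finite_lt_nat N).image e).subset fun n hn => ?_
    obtain ⟨k, rfl⟩ := hEJ hn
    refine ⟨k, ?_, rfl⟩
    by_contra hk
    exact hN k (not_lt.1 hk) hn

/-- If only finite sets are expandable, every ball around `{x n | n ∈ A}` contains the sets between
some finite subset and it. -/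
theorem exists_finset_forall_lt
    (hlf : LocallyFinite fun n => ({x n} : Set X)) (hx : Function.Injective x)
    {d : CL X → CL X → ℝ} (h : Symmetrizes d)
    (hfin : ∀ E, Expandable x E → E.Finite) (A : Set ℕ) (hA : A.Nonempty) {ε : ℝ} (hε : 0 < ε) :
    ∃ F : Finset ℕ, ↑F ⊆ A ∧ ∀ B hB, ↑F ⊆ B → B ⊆ A → B ≠ A →
      d (image hlf A hA) (image hlf B hB) < ε := by
  classical
  by_contra! hcon
  have hk : ∀ k : ℕ, ∃ B, ∃ hB : B.Nonempty, (∀ n ∈ A, n < k → n ∈ B) ∧ B ⊆ A ∧ B ≠ A ∧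
      ε ≤ d (image hlf A hA) (image hlf B hB) := by
    intro k
    obtain ⟨B, hB, hFB, hBA, hne, hd⟩ := hcon ((Finset.range k).filter (· ∈ A)) (by
      intro n hn
      exact (Finset.mem_filter.1 hn).2)
    exact ⟨B, hB, fun n hn hnk => hFB (by simp [hn, hnk]), hBA, hne, hd⟩
  choose B hB hkB hBA hne hd using hk
  suffices ∃ k, d (image hlf A hA) (image hlf (B k) (hB k)) < ε by
    obtain ⟨k, hk⟩ := this
    exact absurd hk (not_lt.2 (hd k))
  refine h.exists_lt_of_unique_cluster (u := fun k => image hlf (B k) (hB k)) ?_ ?_ ?_ hε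
  · rintro ⟨k, hk⟩
    exact hne k (hx.image_injective (congrArg Subtype.val hk))
  · refine Tendsto.mapClusterPt fun s hs => ?_
    obtain ⟨O, hOs, hO, hAO⟩ := mem_nhds_iff.1 hs
    obtain ⟨E, hEA, hE, hEO⟩ := exists_interval_subset hlf hO hAO
    obtain ⟨N, hN⟩ := (hfin E hE).bddAbove
    rw [mem_map]
    filter_upwards [eventually_gt_atTop N] with k hk
    exact hOs (hEO _ (hB k) (fun n hn => hkB k n (hEA hn) ((hN hn).trans_lt hk)) (hBA k))
  · intro z hz
    rw [mapClusterPt_iff_frequently] at hz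
    have hzA : z.1 ⊆ x '' A := by
      by_contra hzA
      obtain ⟨k, hk⟩ := (hz _ ((isClosed_setOf_subset
        (isClosed_image_of_locallyFinite hlf A)).isOpen_compl.mem_nhds hzA)).exists
      exact hk (image_mono (hBA k))
    refine Subtype.ext (hzA.antisymm ?_)
    rintro _ ⟨n, hn, rfl⟩
    by_contra hnz
    obtain ⟨k, hk, hkz⟩ := frequently_atTop.1 (hz _ ((isOpen_upper
      (isOpen_compl_singleton (x := x n))).mem_nhds (subset_compl_singleton_iff.2 hnz))) (n + 1)
    exact hkz ⟨n, hkB k n hn hk, rfl⟩ rfl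

/-- The power set of `ℕ` contains a chain indexed by the reals. If only finite sets were expandable,
two members of the chain would be given the same radius and the same finite set by
`exists_finset_forall_lt`, and then the larger would be a subset of the smaller. -/
theorem exists_infinite_expandable
    (hlf : LocallyFinite fun n => ({x n} : Set X)) (hx : Function.Injective x)
    {d : CL X → CL X → ℝ} (h : Symmetrizes d) :
    ∃ E : Set ℕ, Expandable x E ∧ E.Infinite := by
  by_contra! hfin
  let q : ℕ ≃ ℚ := (Denumerable.eqv ℚ).symm
  let A : ℝ → Set ℕ := fun r => {n | (q n : ℝ) < r}
  have hA : ∀ r, (A r).Nonempty := by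
    intro r
    obtain ⟨p, hp⟩ := exists_rat_lt r
    exact ⟨q.symm p, by simpa [A] using hp⟩
  have hp : ∀ r, ∃ p : ℕ × Finset ℕ,
      (∀ C hC, d (image hlf (A r) (hA r)) (image hlf C hC) < 1 / ((p.1 : ℝ) + 1) → C ⊆ A r) ∧
      ↑p.2 ⊆ A r ∧ ∀ B hB, ↑p.2 ⊆ B → B ⊆ A r → B ≠ A r →
        d (image hlf (A r) (hA r)) (image hlf B hB) < 1 / ((p.1 : ℝ) + 1) := by
    intro r
    obtain ⟨ε, hε, hb⟩ := h.exists_ball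
      (isOpen_upper (isClosed_image_of_locallyFinite hlf (A r)ᶜ).isOpen_compl)
      (show image hlf (A r) (hA r) ∈ upper (x '' (A r)ᶜ)ᶜ by
        rintro _ ⟨n, hn, rfl⟩ ⟨m, hm, hmn⟩
        exact hm (hx hmn ▸ hn))
    obtain ⟨m, hm⟩ := exists_nat_one_div_lt hε
    obtain ⟨F, hFA, hF⟩ := exists_finset_forall_lt hlf hx h hfin (A r) (hA r)
      (ε := 1 / ((m : ℝ) + 1)) (by positivity)
    refine ⟨(m, F), fun C hC hd n hn => ?_, hFA, hF⟩
    by_contra hnA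
    exact hb _ (hd.trans hm) ⟨n, hn, rfl⟩ ⟨n, hnA, rfl⟩
  choose p hp₁ hp₂ hp₃ using hp
  have hninj : ¬ Function.Injective p := fun hinj => not_countable (α := ℝ) hinj.countable
  have hlt : ∀ r s, r < s → p r ≠ p s := by
    intro r s hrs hpe
    obtain ⟨a, hra, has⟩ := exists_rat_btwn hrs
    have hns : q.symm a ∈ A s := by simpa [A] using has
    have hnr : q.symm a ∉ A r := by simpa [A] using hra.le
    have hsub : A r ⊆ A s := fun n hn => lt_trans hn hrs
    have hd := hp₃ s (A r) (hA r) (hpe ▸ hp₂ r) hsub (fun he => hnr (he ▸ hns))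
    rw [h.1.symm, ← hpe] at hd
    exact hnr (hp₁ r (A s) (hA s) hd hns)
  apply hninj
  intro r s hrs
  rcases lt_trichotomy r s with hlt' | he | hlt'
  · exact absurd hrs (hlt _ _ hlt')
  · exact he
  · exact absurd hrs.symm (hlt _ _ hlt')

theorem expandable_univ
    (hlf : LocallyFinite fun n => ({x n} : Set X)) (hx : Function.Injective x)
    {d : CL X → CL X → ℝ} (h : Symmetrizes d) : Expandable x univ := by
  by_contra hne
  obtain ⟨J, hJ, hJE⟩ := exists_infinite_forall_expandable_finite hlf hx h hne
  have hφ : Function.Injective fun n => (hJ.natEmbedding J n : ℕ) :=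
    Subtype.val_injective.comp (hJ.natEmbedding J).injective
  obtain ⟨E, hE, hEi⟩ := exists_infinite_expandable (x := x ∘ fun n => (hJ.natEmbedding J n : ℕ))
    (hlf.comp_injective hφ) (hx.comp hφ) h
  refine hEi (Finite.of_finite_image (hJE _ ?_ (hE.of_comp hφ)) hφ.injOn)
  rintro _ ⟨n, -, rfl⟩
  exact (hJ.natEmbedding J n).2

/-- If `x` is expandable and its points are not isolated, perturbing all the points at once inside
neighbourhoods `U n` approximates the range of `x`, but no sequence of such perturbations converges
to it: a set containing one new point of each, from different `U n`, is closed and misses it. -/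
theorem exists_isOpen_singleton
    (hlf : LocallyFinite fun n => ({x n} : Set X)) (hx : Function.Injective x)
    {d : CL X → CL X → ℝ} (h : Symmetrizes d)
    (hE : Expandable x univ) : ∃ n, IsOpen {x n} := by
  by_contra! hiso
  obtain ⟨U, hU, hUlf, hxU⟩ := hE
  have hDc : IsClosed (range x) := by
    rw [← image_univ]
    exact isClosed_image_of_locallyFinite hlf univ
  have hcl : IsClosed {B : CL X | ∀ N, ∃ n, N ≤ n ∧ (B.1 ∩ (U n \ range x)).Nonempty} := by
    refine h.isClosed_of_separated fun C hC => ?_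
    by_contra! hcon
    simp only [mem_ofPred_eq, not_forall, not_exists, not_and] at hC
    obtain ⟨N, hN⟩ := hC
    choose B hB hBd using fun k : ℕ => hcon (1 / ((k : ℝ) + 1)) (by positivity)
    choose n hn b hb using fun k => hB k (max N k)
    have hblf : LocallyFinite fun k => ({b k} : Set X) := by
      intro z
      obtain ⟨t, ht, hf⟩ := hUlf z
      obtain ⟨M, hM⟩ := hf.bddAbove
      refine ⟨t, ht, (finite_le_nat M).subset ?_⟩
      rintro k ⟨_, rfl, hbt⟩
      exact (le_max_right N k).trans ((hn k).trans (hM ⟨b k, (hb k).2.1, hbt⟩))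
    have hbc := isClosed_image_of_locallyFinite hblf univ
    rw [image_univ] at hbc
    obtain ⟨ε, hε, hball⟩ := h.exists_ball (isOpen_upper hbc.isOpen_compl)
      (show C ∈ upper (range b)ᶜ by
        rintro _ hC ⟨k, rfl⟩
        exact hN (n k) ((le_max_left _ _).trans (hn k)) ⟨b k, hC, (hb k).2⟩)
    obtain ⟨k, hk⟩ := exists_nat_one_div_lt hε
    exact hball _ ((hBd k).trans hk) (hb k).1 (mem_range_self k)
  have hD : image hlf univ univ_nonempty ∉
      {B : CL X | ∀ N, ∃ n, N ≤ n ∧ (B.1 ∩ (U n \ range x)).Nonempty} := by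
    intro hD
    obtain ⟨n, -, y, hy, hy'⟩ := hD 0
    exact hy'.2 (image_subset_range _ _ hy)
  obtain ⟨W, hW, hxW, hWO⟩ : ∃ W : ℕ → Set X, (∀ n, IsOpen (W n)) ∧ (∀ n, x n ∈ W n) ∧
      ∀ B : CL X, B.1 ⊆ ⋃ n, W n → (∀ n, (B.1 ∩ W n).Nonempty) →
        B ∈ {B : CL X | ∀ N, ∃ n, N ≤ n ∧ (B.1 ∩ (U n \ range x)).Nonempty}ᶜ := by
    refine nhds_induction (A := image hlf univ univ_nonempty)
      (p := fun O => ∃ W : ℕ → Set X, (∀ n, IsOpen (W n)) ∧ (∀ n, x n ∈ W n) ∧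
        ∀ B : CL X, B.1 ⊆ ⋃ n, W n → (∀ n, (B.1 ∩ W n).Nonempty) → B ∈ O)
      ?_ ?_ ?_ ?_ ?_ hcl.isOpen_compl hD
    · exact ⟨fun _ => univ, fun _ => isOpen_univ, fun _ => mem_univ _, fun _ _ _ => mem_univ _⟩
    · rintro O O' hOO' ⟨W, hW, hxW, h⟩
      exact ⟨W, hW, hxW, fun B hB hB' => hOO' (h B hB hB')⟩
    · rintro O O' ⟨W, hW, hxW, h⟩ ⟨W', hW', hxW', h'⟩
      refine ⟨fun n => W n ∩ W' n, fun n => (hW n).inter (hW' n), fun n => ⟨hxW n, hxW' n⟩,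
        fun B hB hB' => ⟨h B (hB.trans (iUnion_mono fun n => inter_subset_left)) fun n => ?_,
          h' B (hB.trans (iUnion_mono fun n => inter_subset_right)) fun n => ?_⟩⟩
      · exact (hB' n).mono (inter_subset_inter_right _ inter_subset_left)
      · exact (hB' n).mono (inter_subset_inter_right _ inter_subset_right)
    · intro V hV hxV
      refine ⟨fun _ => V, fun _ => hV, fun n => hxV ⟨n, mem_univ n, rfl⟩, fun B hB _ => ?_⟩
      rwa [iUnion_const] at hB
    · intro 𝒰 h𝒰 h𝒰lf hx𝒰
      refine ⟨fun n => ⋂ V ∈ {V : 𝒰 | x n ∈ (V : Set X)}, (V : Set X),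
        fun n => (h𝒰lf.point_finite (x n)).isOpen_biInter fun V _ => h𝒰 V V.2,
        fun n => by simp, fun B _ hB V hV => ?_⟩
      obtain ⟨_, ⟨n, -, rfl⟩, hnV⟩ := hx𝒰 V hV
      obtain ⟨y, hyB, hy⟩ := hB n
      exact ⟨y, hyB, mem_iInter₂.1 hy ⟨V, hV⟩ hnV⟩
  have hy : ∀ n, ∃ y ∈ W n, y ∈ U n ∧ y ∉ range x := by
    intro n
    by_contra! hcon
    apply hiso n
    have : ({x n} : Set X) = (W n ∩ U n) \ x '' {n}ᶜ := by
      refine Subset.antisymm ?_ ?_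
      · rintro _ rfl
        refine ⟨⟨hxW n, hxU n (mem_univ n)⟩, ?_⟩
        rintro ⟨m, hm, hmn⟩
        exact hm (hx hmn)
      · rintro y ⟨⟨hyW, hyU⟩, hyn⟩
        obtain ⟨m, rfl⟩ := hcon y hyW hyU
        by_contra hmn
        exact hyn ⟨m, fun he => hmn (congrArg x he), rfl⟩
    rw [this]
    exact ((hW n).inter (hU n)).sdiff (isClosed_image_of_locallyFinite hlf _)
  choose y hyW hyU hyx using hy
  have hylf : LocallyFinite fun n => ({y n} : Set X) :=
    hUlf.subset fun n => singleton_subset_iff.2 (hyU n)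
  refine hWO (image hylf univ univ_nonempty) ?_ (fun n => ⟨y n, ⟨n, mem_univ n, rfl⟩, hyW n⟩)
    fun N => ⟨N, le_rfl, y N, ⟨N, mem_univ N, rfl⟩, hyU N, hyx N⟩
  rintro _ ⟨n, -, rfl⟩
  exact mem_iUnion.2 ⟨n, hyW n⟩

end

theorem _root_.isClosed_nonIsolatedPoints : IsClosed (nonIsolatedPoints X) := by
  rw [← isOpen_compl_iff, isOpen_iff_forall_mem_open]
  intro z hz
  have hz' : IsOpen {z} := not_not.1 hz
  exact ⟨{z}, singleton_subset_iff.2 hz, hz', rfl⟩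

theorem isCountablyCompact_nonIsolatedPoints [T1Space X] {d : CL X → CL X → ℝ}
    (h : Symmetrizes d) : IsCountablyCompact (nonIsolatedPoints X) := by
  rw [isCountablyCompact_iff_infinite_subset_has_accPt]
  intro B hB hBi
  by_contra! hacc
  have hx : Function.Injective fun n => (hBi.natEmbedding B n : X) :=
    Subtype.val_injective.comp (hBi.natEmbedding B).injective
  have hlf : LocallyFinite fun n => ({(hBi.natEmbedding B n : X)} : Set X) := by
    intro z
    obtain ⟨t, ht, htz⟩ : ∃ t ∈ 𝓝 z, ∀ y ∈ t, y ∈ B → y = z := by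
      by_cases hz : z ∈ nonIsolatedPoints X
      · have := hacc z hz
        rw [accPt_iff_nhds] at this
        push Not at this
        obtain ⟨t, ht, h⟩ := this
        exact ⟨t, ht, fun y hy hyB => h y ⟨hy, hyB⟩⟩
      · have hz' : IsOpen {z} := not_not.1 hz
        exact ⟨{z}, hz'.mem_nhds rfl, fun y hy _ => hy⟩
    refine ⟨t, ht, Set.Subsingleton.finite ?_⟩
    rintro m ⟨_, rfl, hm⟩ n ⟨_, rfl, hn⟩
    exact hx ((htz _ hm (hBi.natEmbedding B m).2).trans (htz _ hn (hBi.natEmbedding B n).2).symm)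
  obtain ⟨n, hn⟩ := exists_isOpen_singleton hlf hx h (expandable_univ hlf hx h)
  exact hB (hBi.natEmbedding B n).2 hn

end CL

/-! ### Gauges of compact sets and metrics adapted to them -/

/-- `g` is a gauge of `K`: a continuous nonnegative function that vanishes exactly on `K` and whose
sublevel sets form a base of neighbourhoods of the set `K`. -/
structure IsGauge {X : Type*} [TopologicalSpace X] (K : Set X) (g : X → ℝ) : Prop where
  continuous : Continuous g
  nonneg : ∀ x, 0 ≤ g x
  eq_zero_iff : ∀ x, g x = 0 ↔ x ∈ K
  exists_lt_subset : ∀ V : Set X, IsOpen V → K ⊆ V → ∃ ε : ℝ, 0 < ε ∧ ∀ x, g x < ε → x ∈ V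

theorem isGauge_one (X : Type*) [TopologicalSpace X] : IsGauge (∅ : Set X) fun _ => 1 :=
  ⟨continuous_const, fun _ => zero_le_one, by simp, fun _ _ _ => ⟨1, one_pos, by simp⟩⟩

theorem IsCompact.exists_isGauge {X : Type*} [TopologicalSpace X]
    [TopologicalSpace.MetrizableSpace X] {K : Set X} (hK : IsCompact K) : ∃ g, IsGauge K g := by
  let := TopologicalSpace.metrizableSpaceMetric X
  rcases K.eq_empty_or_nonempty with rfl | hne
  · exact ⟨_, isGauge_one X⟩
  refine ⟨fun x => Metric.infDist x K, Metric.continuous_infDist_pt K,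
    fun x => Metric.infDist_nonneg, fun x => (hK.isClosed.mem_iff_infDist_zero hne).symm,
    fun V hV hKV => ?_⟩
  obtain ⟨δ, hδ, hsub⟩ := hK.exists_thickening_subset_open hV hKV
  refine ⟨δ, hδ, fun x hx => hsub ?_⟩
  rw [Metric.mem_thickening_iff]
  exact (Metric.infDist_lt_iff hne).1 hx

/-- In a space whose points outside the compact set `K` are isolated, a gauge of `K` and a
continuous map to a metric space that is injective on `K` determine a compatible metric; distinct
points are at distance at least the values of the gauge at each of them. -/
theorem IsGauge.exists_metricSpace {X M : Type*} [t : TopologicalSpace X] [MetricSpace M]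
    {K : Set X} {g : X → ℝ} (hg : IsGauge K g) (hK : IsCompact K) (hiso : ∀ x ∉ K, IsOpen {x})
    {F : X → M} (hF : Continuous F) (hinj : InjOn F K) :
    ∃ m : MetricSpace X, m.toUniformSpace.toTopologicalSpace = t ∧
      ∀ x y, x ≠ y → g x ≤ m.dist x y := by
  classical
  let D : X → X → ℝ := fun x y => if x = y then 0 else max (dist (F x) (F y)) (max (g x) (g y))
  have hD : ∀ x y, x ≠ y → D x y = max (dist (F x) (F y)) (max (g x) (g y)) :=
    fun x y hxy => if_neg hxy
  have hDself : ∀ x, D x x = 0 := fun x => if_pos rfl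
  have hgD : ∀ x y, x ≠ y → g x ≤ D x y := fun x y hxy => by
    rw [hD x y hxy]
    exact (le_max_left _ _).trans (le_max_right _ _)
  have hcomm : ∀ x y, D x y = D y x := by
    intro x y
    by_cases hxy : x = y
    · rw [hxy]
    · rw [hD x y hxy, hD y x (Ne.symm hxy), dist_comm, max_comm (g x)]
  have hnonneg : ∀ x y, 0 ≤ D x y := by
    intro x y
    by_cases hxy : x = y
    · rw [hxy, hDself]
    · exact (hg.nonneg x).trans (hgD x y hxy)
  have htri : ∀ x y z, D x z ≤ D x y + D y z := by
    intro x y z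
    by_cases hxy : x = y
    · rw [hxy, hDself, zero_add]
    by_cases hyz : y = z
    · rw [hyz, hDself, add_zero]
    by_cases hxz : x = z
    · rw [hxz, hDself]
      exact add_nonneg (hnonneg _ _) (hnonneg _ _)
    rw [hD x z hxz]
    refine max_le ?_ (max_le ?_ ?_)
    · refine (dist_triangle (F x) (F y) (F z)).trans (add_le_add ?_ ?_)
      · rw [hD x y hxy]
        exact le_max_left _ _
      · rw [hD y z hyz]
        exact le_max_left _ _
    · exact (hgD x y hxy).trans (le_add_of_nonneg_right (hnonneg _ _))
    · rw [hcomm y z]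
      exact (hgD z y (Ne.symm hyz)).trans (le_add_of_nonneg_left (hnonneg _ _))
  have hzero : ∀ x y, D x y = 0 → x = y := by
    intro x y h0
    by_contra hxy
    have hx : g x = 0 := le_antisymm (h0 ▸ hgD x y hxy) (hg.nonneg x)
    have hy : g y = 0 := by
      rw [hcomm] at h0
      exact le_antisymm (h0 ▸ hgD y x (Ne.symm hxy)) (hg.nonneg y)
    refine hxy (hinj ((hg.eq_zero_iff x).1 hx) ((hg.eq_zero_iff y).1 hy) ?_)
    refine dist_le_zero.1 ?_
    rw [← h0, hD x y hxy]
    exact le_max_left _ _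
  have hopen : ∀ s : Set X, IsOpen s ↔ ∀ x ∈ s, ∃ ε > 0, ∀ y, D x y < ε → y ∈ s := by
    intro s
    constructor
    · intro hs x hx
      by_cases hxK : x ∈ K
      · have hFx : F x ∉ F '' (K \ s) := by
          rintro ⟨y, ⟨hyK, hys⟩, hyx⟩
          exact hys (hinj hyK hxK hyx ▸ hx)
        obtain ⟨ε, hε, hball⟩ := Metric.isOpen_iff.1
          ((hK.diff hs).image hF).isClosed.isOpen_compl (F x) hFx
        have hV : IsOpen (s ∪ {y | ε / 2 < dist (F x) (F y)}) :=
          hs.union (isOpen_lt continuous_const (continuous_const.dist hF))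
        obtain ⟨δ, hδ, hsub⟩ := hg.exists_lt_subset _ hV (by
          intro y hy
          by_cases hys : y ∈ s
          · exact Or.inl hys
          · refine Or.inr ?_
            by_contra hlt
            refine hball (a := F y) ?_ ⟨y, ⟨hy, hys⟩, rfl⟩
            rw [Metric.mem_ball, dist_comm]
            exact (not_lt.1 hlt).trans_lt (half_lt_self hε))
        refine ⟨min (ε / 2) δ, lt_min (half_pos hε) hδ, fun y hy => ?_⟩
        by_cases hxy : x = y
        · exact hxy ▸ hx
        rw [hD x y hxy, max_lt_iff, max_lt_iff] at hy
        rcases hsub y (hy.2.2.trans_le (min_le_right _ _)) with hys | hys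
        · exact hys
        · exact absurd (hy.1.trans_le (min_le_left _ _)) (not_lt.2 (le_of_lt hys))
      · refine ⟨g x, lt_of_le_of_ne (hg.nonneg x) fun h0 => hxK ((hg.eq_zero_iff x).1 h0.symm),
          fun y hy => ?_⟩
        by_contra hys
        exact absurd hy (not_lt.2 (hgD x y fun hxy => hys (hxy ▸ hx)))
    · intro hs
      rw [isOpen_iff_mem_nhds]
      intro x hx
      by_cases hxK : x ∈ K
      · obtain ⟨ε, hε, hball⟩ := hs x hx
        have hgx := (hg.eq_zero_iff x).2 hxK
        have h₁ : ∀ᶠ y in 𝓝 x, dist (F x) (F y) < ε :=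
          (continuous_const.dist hF).continuousAt.eventually_lt continuousAt_const (by simpa)
        have h₂ : ∀ᶠ y in 𝓝 x, g y < ε :=
          hg.continuous.continuousAt.eventually_lt continuousAt_const (by rwa [hgx])
        filter_upwards [h₁, h₂] with y hy₁ hy₂
        refine hball y ?_
        by_cases hxy : x = y
        · rwa [hxy, hDself]
        · rw [hD x y hxy, hgx]
          exact max_lt hy₁ (max_lt hε hy₂)
      · exact mem_of_superset ((hiso x hxK).mem_nhds rfl) (singleton_subset_iff.2 hx)
  exact ⟨MetricSpace.ofDistTopology D hDself hcomm htri hopen hzero, rfl, hgD⟩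

/-! ### The locally finite topology as a Hausdorff metric topology -/

namespace CL

section

variable {X : Type*} [MetricSpace X] {K : Set X} {g : X → ℝ}

theorem exists_forall_lt_mem_of_subset (hK : IsCompact K) (hg : IsGauge K g)
    (hdist : ∀ x y, x ≠ y → g x ≤ dist x y) {A V : Set X} (hA : IsClosed A) (hV : IsOpen V)
    (hAV : A ⊆ V) : ∃ ε : ℝ, 0 < ε ∧ ∀ a ∈ A, ∀ y, dist a y < ε → y ∈ V := by
  obtain ⟨δ, hδ, hsub⟩ := (hK.inter_right hA).exists_thickening_subset_open hV
    (inter_subset_right.trans hAV)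
  obtain ⟨η, hη, hsub'⟩ := hg.exists_lt_subset (Metric.thickening (δ / 2) (K ∩ A) ∪ Aᶜ)
    (Metric.isOpen_thickening.union hA.isOpen_compl) (by
      intro x hx
      by_cases hxA : x ∈ A
      · exact Or.inl (Metric.self_subset_thickening (half_pos hδ) _ ⟨hx, hxA⟩)
      · exact Or.inr hxA)
  refine ⟨min (δ / 2) η, lt_min (half_pos hδ) hη, fun a ha y hy => ?_⟩
  by_cases hay : a = y
  · exact hay ▸ hAV ha
  rcases hsub' a ((hdist a y hay).trans_lt (hy.trans_le (min_le_right _ _))) with hat | hat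
  · rw [Metric.mem_thickening_iff] at hat
    obtain ⟨k, hk, hak⟩ := hat
    refine hsub (Metric.mem_thickening_iff.2 ⟨k, hk, ?_⟩)
    have h₁ := dist_triangle y a k
    have h₂ := hy.trans_le (min_le_left _ _)
    rw [dist_comm] at h₂
    linarith
  · exact absurd ha hat

/-- Near `K` only finitely many members of a locally finite family matter, and away from `K` small
balls are singletons, so the members of the family contain balls of a common radius. -/
theorem exists_forall_lt_mem_of_mem_lower (hK : IsCompact K) (hg : IsGauge K g)
    (hdist : ∀ x y, x ≠ y → g x ≤ dist x y) {A : CL X} {𝒰 : Set (Set X)}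
    (h𝒰 : ∀ U ∈ 𝒰, IsOpen U) (hlf : LocallyFinite fun U : 𝒰 => (U : Set X)) (hA : A ∈ lower 𝒰) :
    ∃ ε : ℝ, 0 < ε ∧ ∀ U ∈ 𝒰, ∃ a ∈ A.1, ∀ y, dist a y < ε → y ∈ U := by
  choose t ht hft using hlf
  obtain ⟨s, -, hs⟩ := hK.elim_nhds_subcover (fun x => interior (t x))
    fun x _ => interior_mem_nhds.2 (ht x)
  obtain ⟨η, hη, hsub⟩ := hg.exists_lt_subset (⋃ x ∈ s, interior (t x))
    (isOpen_biUnion fun x _ => isOpen_interior) hs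
  have hfin : {U : 𝒰 | ∃ a ∈ (U : Set X), a ∈ ⋃ x ∈ s, interior (t x)}.Finite := by
    refine (s.finite_toSet.biUnion fun x _ => hft x).subset ?_
    rintro U ⟨a, haU, ha⟩
    obtain ⟨x, hx, hax⟩ := mem_iUnion₂.1 ha
    exact mem_biUnion hx ⟨a, haU, interior_subset hax⟩
  have hnear : ∀ᶠ ε : ℝ in 𝓝[>] 0,
      ∀ U ∈ {U : 𝒰 | ∃ a ∈ (U : Set X), a ∈ ⋃ x ∈ s, interior (t x)},
        ∃ a ∈ A.1, ∀ y, dist a y < ε → y ∈ (U : Set X) := by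
    rw [eventually_all_finite hfin]
    intro U _
    obtain ⟨a, ha, haU⟩ := hA U U.2
    obtain ⟨δ, hδ, hball⟩ := Metric.isOpen_iff.1 (h𝒰 U U.2) a haU
    filter_upwards [Ioo_mem_nhdsGT hδ] with ε hε
    refine ⟨a, ha, fun y hy => hball ?_⟩
    rw [Metric.mem_ball, dist_comm]
    exact hy.trans hε.2
  obtain ⟨ε, hε, hε'⟩ := (hnear.and (Ioo_mem_nhdsGT hη)).exists
  refine ⟨ε, hε'.1, fun U hU => ?_⟩
  by_cases hUs : ∃ a ∈ U, a ∈ ⋃ x ∈ s, interior (t x)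
  · exact hε ⟨U, hU⟩ hUs
  · obtain ⟨a, ha, haU⟩ := hA U hU
    refine ⟨a, ha, fun y hy => ?_⟩
    by_cases hay : a = y
    · exact hay ▸ haU
    · exact absurd ⟨a, haU, hsub a ((hdist a y hay).trans_lt (hy.trans hε'.2))⟩ hUs

/-- In any metric space, the locally finite topology is finer than that of the Hausdorff
distance; the lower half uses a locally finite refinement of the cover by small balls. -/
theorem continuous_toCloseds :
    Continuous fun A : CL X => (⟨A.1, A.2.1⟩ : TopologicalSpace.Closeds X) := by
  refine continuous_iff_continuousAt.2 fun A => EMetric.tendsto_nhds.2 fun ε hε => ?_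
  obtain ⟨δ, -, hδ, hδε⟩ := ENNReal.lt_iff_exists_real_btwn.1 hε
  have hδ0 : 0 < δ := ENNReal.ofReal_pos.1 hδ
  obtain ⟨v, hv, hvc, hvlf, hvb⟩ := precise_refinement (fun x : X => Metric.ball x (δ / 2))
    (fun x => Metric.isOpen_ball)
    (eq_univ_of_forall fun x => mem_iUnion.2 ⟨x, Metric.mem_ball_self (half_pos hδ0)⟩)
  have hlow := isOpen_lower_range (U := fun i : {i | (A.1 ∩ v i).Nonempty} => v i)
    (fun i => hv i) (hvlf.comp_injective Subtype.val_injective)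
  have hup := isOpen_upper (Metric.isOpen_thickening (δ := δ) (E := A.1))
  filter_upwards [hlow.mem_nhds fun i => i.2,
    hup.mem_nhds (Metric.self_subset_thickening hδ0 A.1)] with B hB hB'
  refine lt_of_le_of_lt (Metric.hausdorffEDist_le_of_mem_edist (r := ENNReal.ofReal δ) ?_ ?_) hδε
  · intro b hb
    obtain ⟨a, ha, hab⟩ := Metric.mem_thickening_iff.1 (hB' hb)
    exact ⟨a, ha, (edist_lt_ofReal.2 hab).le⟩
  · intro a ha
    obtain ⟨i, hi⟩ := mem_iUnion.1 (hvc ▸ mem_univ a)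
    obtain ⟨b, hb, hbi⟩ := hB ⟨i, a, ha, hi⟩
    refine ⟨b, hb, (edist_lt_ofReal.2 ?_).le⟩
    have h₁ := Metric.mem_ball.1 (hvb i hi)
    have h₂ := Metric.mem_ball'.1 (hvb i hbi)
    have h₃ := dist_triangle a i b
    linarith

theorem isEmbedding_toCloseds (hK : IsCompact K) (hg : IsGauge K g)
    (hdist : ∀ x y, x ≠ y → g x ≤ dist x y) :
    IsEmbedding fun A : CL X => (⟨A.1, A.2.1⟩ : TopologicalSpace.Closeds X) := by
  refine ⟨⟨le_antisymm continuous_toCloseds.le_induced (le_generateFrom fun S hS => ?_)⟩,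
    fun A B hAB => Subtype.ext (congrArg (fun C : TopologicalSpace.Closeds X => (C : Set X)) hAB)⟩
  suffices ∀ A ∈ S, ∃ ε : ℝ, 0 < ε ∧
      ∀ B : CL X, Metric.hausdorffEDist B.1 A.1 < ENNReal.ofReal ε → B ∈ S by
    rw [@isOpen_iff_mem_nhds _ (_) (_)]
    intro A hA
    obtain ⟨ε, hε, hB⟩ := this A hA
    rw [nhds_induced]
    exact ⟨_, Metric.eball_mem_nhds _ (ENNReal.ofReal_pos.2 hε), fun B hBA => hB B hBA⟩
  intro A hA
  rcases hS with ⟨V, hV, rfl⟩ | ⟨𝒰, h𝒰, hlf, rfl⟩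
  · obtain ⟨ε, hε, hball⟩ := exists_forall_lt_mem_of_subset hK hg hdist A.2.1 hV hA
    refine ⟨ε, hε, fun B hBA b hb => ?_⟩
    obtain ⟨a, ha, hba⟩ := Metric.exists_edist_lt_of_hausdorffEDist_lt hb hBA
    rw [edist_comm] at hba
    exact hball a ha b (edist_lt_ofReal.1 hba)
  · obtain ⟨ε, hε, hball⟩ := exists_forall_lt_mem_of_mem_lower hK hg hdist h𝒰 hlf hA
    refine ⟨ε, hε, fun B hBA U hU => ?_⟩
    obtain ⟨a, ha, haU⟩ := hball U hU
    rw [Metric.hausdorffEDist_comm] at hBA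
    obtain ⟨b, hb, hab⟩ := Metric.exists_edist_lt_of_hausdorffEDist_lt ha hBA
    exact ⟨b, hb, haU b (edist_lt_ofReal.1 hab)⟩

end

theorem metrizableSpace {X : Type*} [t : TopologicalSpace X] [TopologicalSpace.MetrizableSpace X]
    (hK : IsCompact (nonIsolatedPoints X)) : TopologicalSpace.MetrizableSpace (CL X) := by
  let := TopologicalSpace.metrizableSpaceMetric X
  obtain ⟨g, hg⟩ := hK.exists_isGauge
  obtain ⟨m, hm, hdist⟩ := hg.exists_metricSpace hK (fun x hx => not_not.1 hx)
    (continuous_id (X := X)) (injOn_id _)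
  clear this
  subst hm
  exact (isEmbedding_toCloseds hK hg hdist).metrizableSpace

end CL

/-! ### Metrizability of the base space -/

namespace CL

variable {X : Type*} [TopologicalSpace X]

theorem normalSpace_of_isCompact [T2Space X] {K : Set X} (hK : IsCompact K)
    (hiso : ∀ x ∉ K, IsOpen {x}) : NormalSpace X := by
  have hopen : ∀ s : Set X, IsOpen (s \ K) := by
    intro s
    rw [← biUnion_of_singleton (s \ K)]
    exact isOpen_biUnion fun x hx => hiso x hx.2
  refine ⟨fun A B hA hB hAB => ?_⟩
  obtain ⟨U, V, hU, hV, hAU, hBV, hUV⟩ := SeparatedNhds.of_isCompact_isCompact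
    (hK.inter_right hA) (hK.inter_right hB)
    (hAB.mono inter_subset_right inter_subset_right)
  refine ⟨U \ B ∪ A \ K, V \ A ∪ B \ K, (hU.sdiff hB).union (hopen A),
    (hV.sdiff hA).union (hopen B), ?_, ?_, ?_⟩
  · intro x hx
    by_cases hxK : x ∈ K
    · exact Or.inl ⟨hAU ⟨hxK, hx⟩, disjoint_left.1 hAB hx⟩
    · exact Or.inr ⟨hx, hxK⟩
  · intro x hx
    by_cases hxK : x ∈ K
    · exact Or.inl ⟨hBV ⟨hxK, hx⟩, disjoint_right.1 hAB hx⟩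
    · exact Or.inr ⟨hx, hxK⟩
  · rw [disjoint_left]
    rintro x (⟨hxU, hxB⟩ | ⟨hxA, -⟩) (⟨hxV, hxA'⟩ | ⟨hxB', -⟩)
    · exact disjoint_left.1 hUV hxU hxV
    · exact hxB hxB'
    · exact hxA' hxA
    · exact disjoint_left.1 hAB hxA hxB'

/-- On a compact set `K` the balls of a symmetric of `X` are relative neighbourhoods of their
centres: the hereditary Lindelöf property makes points of `K` relative `Gδ`-sets. -/
theorem exists_isOpen_forall_lt [T2Space X] {d : CL X → CL X → ℝ} (h : Symmetrizes d)
    {e : X → X → ℝ} (he : Symmetrizes e) {K : Set X} (hK : IsCompact K) (p : X) {ε : ℝ}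
    (hε : 0 < ε) : ∃ O : Set X, IsOpen O ∧ p ∈ O ∧ ∀ y ∈ O, y ∈ K → y ≠ p → e p y < ε := by
  by_contra! hcon
  obtain ⟨𝒞, h𝒞, hc, hsub⟩ := exists_countable_subcover h hK.isClosed hK.isCountablyCompact
    (𝒱 := {V | IsOpen V ∧ ∃ O, IsOpen O ∧ p ∈ O ∧ Disjoint O V}) fun V hV => hV.1
  obtain ⟨W, hW⟩ := (hc.insert ∅).exists_eq_range (insert_nonempty _ _)
  have hWO : ∀ i, IsOpen (W i) ∧ ∃ O, IsOpen O ∧ p ∈ O ∧ Disjoint O (W i) := by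
    intro i
    have hi : W i ∈ insert ∅ 𝒞 := hW ▸ mem_range_self i
    rcases hi with hi | hi
    · rw [hi]
      exact ⟨isOpen_empty, univ, isOpen_univ, mem_univ p, disjoint_empty _⟩
    · exact h𝒞 hi
  choose hWo O hO hpO hOW using hWO
  choose y hyO hyK hyp hey using fun k : ℕ => hcon (⋂ i ∈ {i | i ≤ k}, O i)
    ((finite_le_nat k).isOpen_biInter fun i _ => hO i) (mem_iInter₂.2 fun i _ => hpO i)
  have hyK' : ∀ᶠ k in atTop, y k ∈ K := Eventually.of_forall hyK
  have huniq : ∀ z, MapClusterPt z atTop y → z = p := by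
    intro z hz
    by_contra hzp
    have hzK : z ∈ K := hK.isClosed.mem_of_mapClusterPt hz hyK'
    obtain ⟨U, V, hU, hV, hzU, hpV, hUV⟩ := t2_separation hzp
    obtain ⟨C, hC, hzC⟩ := hsub ⟨hzK, U, ⟨hU, V, hV, hpV, hUV.symm⟩, hzU⟩
    obtain ⟨i, rfl⟩ : C ∈ range W := hW ▸ mem_insert_of_mem _ hC
    obtain ⟨k, hk, hyk⟩ := frequently_atTop.1
      (mapClusterPt_iff_frequently.1 hz _ ((hWo i).mem_nhds hzC)) i
    exact disjoint_left.1 (hOW i) (mem_iInter₂.1 (hyO k) i hk) hyk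
  obtain ⟨z, -, hz⟩ := hK.exists_mapClusterPt (le_principal_iff.2 hyK')
  have hzp := huniq z hz
  subst hzp
  obtain ⟨k, hk⟩ := he.exists_lt_of_unique_cluster
    (by rintro ⟨k, hk⟩; exact hyp k hk) hz huniq hε
  exact absurd hk (not_lt.2 (hey k))

/-- Urysohn functions for finite subcovers by relative balls of radius `1 / (n + 1)`, for all `n`,
form a countable family that separates the points of `K`: if two points lie in common balls of
arbitrarily small radius, the centres of these balls converge to both. -/
theorem exists_continuous_injOn.{u} {X : Type u} [TopologicalSpace X] [T2Space X]
    {d : CL X → CL X → ℝ} (h : Symmetrizes d)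
    {K : Set X} (hK : IsCompact K) (hiso : ∀ x ∉ K, IsOpen {x}) :
    ∃ ι : Type u, Countable ι ∧ ∃ F : X → ι → ℝ, Continuous F ∧ InjOn F K := by
  have := normalSpace_of_isCompact hK hiso
  have he := h.of_isClosedEmbedding isClosedEmbedding_singleton (X := X)
  set e : X → X → ℝ := fun x y => d (insertPt ∅ isClosed_empty x) (insertPt ∅ isClosed_empty y)
  have hf : ∀ (n : ℕ) (p : X), ∃ f : X → ℝ, Continuous f ∧ f p = 0 ∧
      ∀ y ∈ K, f y < 1 → y ≠ p → e p y < 1 / ((n : ℝ) + 1) := by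
    intro n p
    obtain ⟨O, hO, hpO, hOe⟩ := exists_isOpen_forall_lt h he hK p
      (ε := 1 / ((n : ℝ) + 1)) (by positivity)
    obtain ⟨f, hf0, hf1, -⟩ := exists_continuous_zero_one_of_isClosed (isClosed_singleton (x := p))
      hO.isClosed_compl (disjoint_singleton_left.2 fun hp => hp hpO)
    refine ⟨f, f.continuous, hf0 rfl, fun y hyK hy => hOe y ?_ hyK⟩
    by_contra hyO
    exact hy.ne (hf1 hyO)
  choose f hfc hfp hfe using hf
  choose t ht hKt using fun n => hK.elim_nhds_subcover (fun p => {y | f n p y < 1}) fun p _ =>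
    (isOpen_lt (hfc n p) continuous_const).mem_nhds (by simp [hfp])
  refine ⟨Σ n, {p // p ∈ t n}, inferInstance, fun y i => f i.1 i.2 y,
    continuous_pi fun i => hfc _ _, fun p hp q hq hpq => ?_⟩
  by_contra hne
  obtain ⟨U, V, hU, hV, hpU, hqV, hUV⟩ := t2_separation hne
  obtain ⟨δ, hδ, hδU⟩ := he.exists_ball hU hpU
  obtain ⟨η, hη, hηV⟩ := he.exists_ball hV hqV
  obtain ⟨n, hn⟩ := exists_nat_one_div_lt (lt_min hδ hη)
  obtain ⟨c, hc, hpc⟩ := mem_iUnion₂.1 (hKt n hp)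
  have hqc : f n c q < 1 := by
    have := congrFun hpq ⟨n, c, hc⟩
    simp only at this
    rw [← this]
    exact hpc
  have hcU : c ∈ U := by
    by_cases hpe : p = c
    · exact hpe ▸ hpU
    · refine hδU c ?_
      rw [he.1.symm]
      exact (hfe n c p hp hpc hpe).trans (hn.trans_le (min_le_left _ _))
  have hcV : c ∈ V := by
    by_cases hqe : q = c
    · exact hqe ▸ hqV
    · refine hηV c ?_
      rw [he.1.symm]
      exact (hfe n c q hq hqc hqe).trans (hn.trans_le (min_le_right _ _))
  exact disjoint_left.1 hUV hcU hcV

theorem _root_.exists_isGauge_of_antitone [T1Space X] {K : Set X}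
    (hiso : ∀ x ∉ K, IsOpen {x}) {S : ℕ → Set X} (hS : ∀ n, IsOpen (S n)) (hKS : ∀ n, K ⊆ S n)
    (hanti : Antitone S) (hbase : ∀ V, IsOpen V → K ⊆ V → ∃ n, S n ⊆ V) : ∃ g, IsGauge K g := by
  classical
  have hex : ∀ x, x ∉ K → ∃ n, x ∉ S n ∧ ∀ m < n, x ∈ S m := by
    intro x hx
    obtain ⟨n, hn⟩ := hbase {x}ᶜ isOpen_compl_singleton (subset_compl_singleton_iff.2 hx)
    have hex : ∃ n, x ∉ S n := ⟨n, fun hxn => hn hxn rfl⟩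
    exact ⟨Nat.find hex, Nat.find_spec hex, fun m hm => not_not.1 (Nat.find_min hex hm)⟩
  choose! N hN hN' using hex
  have hlt : ∀ x m, x ∉ K → x ∈ S m → m < N x := by
    intro x m hx hxm
    by_contra hle
    exact hN x hx (hanti (not_lt.1 hle) hxm)
  let g : X → ℝ := fun x => if x ∈ K then 0 else 1 / ((N x : ℝ) + 1)
  have hgK : ∀ x ∈ K, g x = 0 := fun x hx => if_pos hx
  have hgN : ∀ x ∉ K, g x = 1 / ((N x : ℝ) + 1) := fun x hx => if_neg hx
  have hpos : ∀ x ∉ K, 0 < g x := fun x hx => by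
    rw [hgN x hx]
    positivity
  have hnonneg : ∀ x, 0 ≤ g x := fun x => by
    by_cases hx : x ∈ K
    · exact (hgK x hx).ge
    · exact (hpos x hx).le
  refine ⟨g, continuous_iff_continuousAt.2 fun x => ?_, hnonneg,
    fun x => ⟨fun h0 => ?_, hgK x⟩, fun V hV hKV => ?_⟩
  · by_cases hx : x ∈ K
    · rw [ContinuousAt, hgK x hx, Metric.tendsto_nhds]
      intro ε hε
      obtain ⟨m, hm⟩ := exists_nat_one_div_lt hε
      filter_upwards [(hS m).mem_nhds (hKS m hx)] with y hy
      rw [Real.dist_eq, sub_zero, abs_of_nonneg (hnonneg y)]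
      by_cases hyK : y ∈ K
      · rwa [hgK y hyK]
      · rw [hgN y hyK]
        exact (Nat.one_div_le_one_div (hlt y m hyK hy).le).trans_lt hm
    · rw [ContinuousAt, (isOpen_singleton_iff_nhds_eq_pure x).1 (hiso x hx)]
      exact tendsto_pure_nhds g x
  · by_contra hx
    exact (hpos x hx).ne' h0
  · obtain ⟨n, hn⟩ := hbase V hV hKV
    refine ⟨1 / ((n : ℝ) + 1), by positivity, fun x hx => ?_⟩
    by_cases hxK : x ∈ K
    · exact hKV hxK
    rw [hgN x hxK, one_div_lt_one_div (by positivity) (by positivity)] at hx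
    have hnN : n < N x := by exact_mod_cast lt_of_add_lt_add_right hx
    exact hn (hN' x hxK n hnN)

/-- If all points outside `K` are isolated, the points added to `K` in a ball around `K` form an
open set: a limit other than `K` of sets `K ∪ {x}` outside the ball is eventually equal to them. -/
theorem isOpen_setOf_mem_or_lt [T2Space X] {d : CL X → CL X → ℝ} (h : Symmetrizes d) {K : Set X}
    (hK : IsClosed K) (hKne : K.Nonempty) (hiso : ∀ x ∉ K, IsOpen {x}) {ε : ℝ} (hε : 0 < ε) :
    IsOpen {x | x ∈ K ∨ d ⟨K, hK, hKne⟩ (insertPt K hK x) < ε} := by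
  have hcl : IsClosed {A | ∃ x, x ∉ K ∧ ε ≤ d ⟨K, hK, hKne⟩ (insertPt K hK x) ∧
      insertPt K hK x = A} := by
    refine h.isClosed_of_separated fun z hz => ?_
    by_contra! hcon
    by_cases hzK : z = ⟨K, hK, hKne⟩
    · subst hzK
      obtain ⟨_, ⟨x, -, hx, rfl⟩, hlt⟩ := hcon ε hε
      exact absurd hlt (not_lt.2 hx)
    have hKz : K ⊆ z.1 := by
      intro k hk
      by_contra hkz
      obtain ⟨δ, hδ, hb⟩ := h.exists_ball (isOpen_upper (isOpen_compl_singleton (x := k)))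
        (show z ∈ upper {k}ᶜ from subset_compl_singleton_iff.2 hkz)
      obtain ⟨_, ⟨x, -, -, rfl⟩, hlt⟩ := hcon δ hδ
      exact hb _ hlt (Or.inr hk) rfl
    have hhit : ∀ b ∈ z.1, b ∉ K → ∃ δ : ℝ, 0 < δ ∧ ∀ x, d z (insertPt K hK x) < δ → x = b := by
      intro b hb hbK
      obtain ⟨δ, hδ, hball⟩ := h.exists_ball (isOpen_hit (hiso b hbK))
        (show z ∈ {A : CL X | (A.1 ∩ {b}).Nonempty} from ⟨b, hb, rfl⟩)
      refine ⟨δ, hδ, fun x hx => ?_⟩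
      obtain ⟨_, hxb | hxb, rfl⟩ := hball _ hx
      · exact hxb.symm
      · exact absurd hxb hbK
    obtain ⟨c, hc, hcK⟩ : ∃ c ∈ z.1, c ∉ K := by
      by_contra! hsub
      exact hzK (Subtype.ext (Subset.antisymm hsub hKz))
    obtain ⟨δ, hδ, hδc⟩ := hhit c hc hcK
    have hzc : insertPt K hK c = z := by
      refine Subtype.ext (Subset.antisymm (insert_subset hc hKz) fun b hb => ?_)
      by_cases hbK : b ∈ K
      · exact Or.inr hbK
      obtain ⟨η, hη, hηb⟩ := hhit b hb hbK
      obtain ⟨_, ⟨x, -, -, rfl⟩, hlt⟩ := hcon (min δ η) (lt_min hδ hη)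
      rw [← hηb x (hlt.trans_le (min_le_right _ _)), hδc x (hlt.trans_le (min_le_left _ _))]
      exact Or.inl rfl
    obtain ⟨_, ⟨x, hxK, hx, rfl⟩, hlt⟩ := hcon δ hδ
    exact hz ⟨x, hxK, hx, by rw [hδc x hlt, hzc]⟩
  rw [← isClosed_compl_iff]
  convert hcl.preimage (continuous_insertPt K hK) using 1
  ext x
  simp only [mem_compl_iff, mem_ofPred_eq, not_or, not_lt, mem_preimage]
  refine ⟨fun hx => ⟨x, hx.1, hx.2, rfl⟩, ?_⟩
  rintro ⟨y, hyK, hy, hyx⟩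
  have : y = x := by
    have hyx' : y ∈ insert x K := by
      have := congrArg Subtype.val hyx
      simp only [insertPt] at this
      rw [← this]
      exact mem_insert _ _
    exact hyx'.resolve_right hyK
  subst this
  exact ⟨hyK, hy⟩

theorem exists_isGauge [T2Space X] {d : CL X → CL X → ℝ} (h : Symmetrizes d) {K : Set X}
    (hK : IsClosed K) (hiso : ∀ x ∉ K, IsOpen {x}) : ∃ g, IsGauge K g := by
  rcases K.eq_empty_or_nonempty with rfl | hKne
  · exact ⟨_, isGauge_one X⟩
  refine exists_isGauge_of_antitone hiso (fun n : ℕ => isOpen_setOf_mem_or_lt h hK hKne hiso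
    (ε := 1 / ((n : ℝ) + 1)) (by positivity)) (fun n x hx => Or.inl hx) ?_ ?_
  · intro m n hmn x hx
    exact hx.imp_right fun hlt => lt_of_lt_of_le hlt (Nat.one_div_le_one_div hmn)
  · intro V hV hKV
    obtain ⟨ε, hε, hb⟩ := h.exists_ball (isOpen_upper hV)
      (show (⟨K, hK, hKne⟩ : CL X) ∈ upper V from hKV)
    obtain ⟨n, hn⟩ := exists_nat_one_div_lt hε
    refine ⟨n, ?_⟩
    rintro x (hx | hx)
    · exact hKV hx
    · exact hb _ (hx.trans hn) (mem_insert _ _)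

theorem metrizableSpace_base_of_symmetrizes [T2Space X] {d : CL X → CL X → ℝ}
    (h : Symmetrizes d) (hK : IsCompact (nonIsolatedPoints X)) :
    TopologicalSpace.MetrizableSpace X := by
  have hiso : ∀ x ∉ nonIsolatedPoints X, IsOpen {x} := fun x hx => not_not.1 hx
  obtain ⟨g, hg⟩ := exists_isGauge h hK.isClosed hiso
  obtain ⟨ι, _, F, hF, hinj⟩ := exists_continuous_injOn h hK hiso
  let := TopologicalSpace.metrizableSpaceMetric (ι → ℝ)
  obtain ⟨m, hm, -⟩ := hg.exists_metricSpace hK hiso hF hinj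
  subst hm
  infer_instance

end CL

theorem theorem2p9 {X : Type*} [TopologicalSpace X] [T2Space X] :
    List.TFAE [
      @TopologicalSpace.MetrizableSpace (CL X) (CL.locFinTopology X),
      @SymmetrizableSpace (CL X) (CL.locFinTopology X),
      TopologicalSpace.MetrizableSpace X ∧ IsCompact (nonIsolatedPoints X)] := by
  tfae_have 1 → 2 := fun _ => SymmetrizableSpace.of_metrizableSpace (CL X)
  tfae_have 2 → 3 := by
    rintro ⟨d, h⟩
    have hK : IsCompact (nonIsolatedPoints X) :=
      CL.isCompact_of_isCountablyCompact h isClosed_nonIsolatedPoints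
        (CL.isCountablyCompact_nonIsolatedPoints h)
    exact ⟨CL.metrizableSpace_base_of_symmetrizes h hK, hK⟩
  tfae_have 3 → 1 := fun ⟨_, hK⟩ => CL.metrizableSpace hK
  tfae_finish
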